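/- Let $\mathscr A$ be an arbitrary complex ${}^*$-algebra (not assumed commutative or unital). For a linear functional $f:\mathscr A\to\mathbb C$ that is positive, i.e. $f(a^*a)\ge 0$ for all $a\in\mathscr A$, we say that $(H,\pi,\xi)$ is a GNS triple of $f$ if $H$ is a complex Hilbert space, $\pi$ is a ${}^*$-representation of $\mathscr A$ by bounded operators on $H$, the vector $\xi\in H$ is cyclic (that is, $\{\pi(a)\xi: a\in\mathscr A\}$ is dense in $H$), and $f(a)=(\pi(a)\xi\,|\,\xi)$ for all $a\in\mathscr A$. A positive functional is representable if it has a GNS triple. For positive functionals $f,g$ write: $f\le g$ if $f(a^*a)\le g(a^*a)$ for all $a\in\mathscr A$; $f$ is dominated by $g$ if $f\le c\,g$ for some constant $c$; $f\ll g$ ($f$ is $g$-absolutely continuous) if $g(a^*a)=0$ implies $f(a^*a)=0$ for every $a\in\mathscr A$; and $f\perp g$ ($f$ and $g$ are singular) if $0$ is the only representable functional that is dominated by both $f$ and $g$. Theorem. Let $f$ and $g$ be representable positive functionals on $\mathscr A$. Then there are representable positive functionals $f_{\ll,g}$ and $f_{\perp,g}$ on $\mathscr A$ such that $$f=f_{\ll,g}+f_{\perp,g},\qquad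 f_{\ll,g}\ll g,\qquad f_{\perp,g}\perp g,$$ and $f_{\ll,g}$ is the greatest among all representable functionals $h$ with $h\le f$ and $h\ll g$; that is, $f_{\ll,g}\le f$, and $h\le f_{\ll,g}$ for every such $h$. Moreover, $f_{\ll,g}$ and $f_{\perp,g}$ are given as follows: if $(H,\pi,\xi)$ is any GNS triple of $f$ and $P$ is the orthogonal projection of $H$ onto the closed subspace generated by $\{\pi(a)\xi : a\in\mathscr A,\ g(a^*a)=0\}$, then for all $a\in\mathscr A$ $$f_{\ll,g}(a)=\big(\pi(a)(I-P)\xi\,\big|\,(I-P)\xi\big),\qquad f_{\perp,g}(a)=\big(\pi(a)P\xi\,\big|\,P\xi\big).$$ -/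

import Mathlib

open scoped ComplexOrder InnerProductSpace

universe u

namespace ShortDecomp

section Defs

variable {A : Type u} [NonUnitalRing A] [StarRing A] [Module ℂ A] [IsScalarTower ℂ A A]
  [SMulCommClass ℂ A A] [StarModule ℂ A]

/-- The sesquilinear form `(a, b) ↦ f (b* a)` induced by a linear functional `f`. -/
def inducedForm (f : A →ₗ[ℂ] ℂ) (a b : A) : ℂ := f (star b * a)

/-- `f (a* a)` is a nonnegative real number for every `a`. -/
def IsPositive (f : A →ₗ[ℂ] ℂ) : Prop := ∀ a : A, 0 ≤ inducedForm f a a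

/-- `(H, π, ξ)` is a GNS triple of `f`: `π` is a `*`-representation of `A` by bounded operators
on the Hilbert space `H`, the vector `ξ` is cyclic for `π`, and `f a = (π a ξ | ξ)` for all `a`.
(Mathlib's inner product is conjugate linear in its first argument.) -/
structure IsGNSTriple (f : A →ₗ[ℂ] ℂ) {H : Type*} [NormedAddCommGroup H] [InnerProductSpace ℂ H]
    [CompleteSpace H] (π : A →⋆ₙₐ[ℂ] (H →L[ℂ] H)) (ξ : H) : Prop where
  cyclic : Dense (Set.range fun a : A => π a ξ)
  apply_eq : ∀ a : A, f a = ⟪ξ, π a ξ⟫_ℂ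

/-- A positive functional is representable if it has a GNS triple. The Hilbert space may be taken
in the universe of `A`, because the completion of a quotient of `A` lives there. -/
def IsRepresentable (f : A →ₗ[ℂ] ℂ) : Prop :=
  IsPositive f ∧
    ∃ (H : Type u) (_ : NormedAddCommGroup H) (_ : InnerProductSpace ℂ H) (_ : CompleteSpace H)
      (π : A →⋆ₙₐ[ℂ] (H →L[ℂ] H)) (ξ : H), IsGNSTriple f π ξ

/-- The order of positive functionals: the order of the quadratic forms of the induced forms. -/
def FunctionalLE (f g : A →ₗ[ℂ] ℂ) : Prop := ∀ a : A, inducedForm f a a ≤ inducedForm g a a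

/-- `f` is `g`-absolutely continuous. -/
def AbsCont (f g : A →ₗ[ℂ] ℂ) : Prop := ∀ a : A, inducedForm g a a = 0 → inducedForm f a a = 0

/-- `h` is dominated by `f`: the form of `h` is at most a constant times the form of `f`. -/
def Dominated (h f : A →ₗ[ℂ] ℂ) : Prop :=
  ∃ c : ℝ, ∀ a : A, inducedForm h a a ≤ (c : ℂ) * inducedForm f a a

/-- `f` and `g` are singular: zero is the only representable functional dominated by both. -/
def Singular (f g : A →ₗ[ℂ] ℂ) : Prop :=
  ∀ h : A →ₗ[ℂ] ℂ, IsRepresentable h → Dominated h f → Dominated h g → h = 0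

/-- The closed subspace of `H` generated by the vectors `π a ξ` with `g (a* a) = 0`. (For a
positive functional `g` these vectors already form a linear subspace.) -/
def nullSpace (g : A →ₗ[ℂ] ℂ) {H : Type*} [NormedAddCommGroup H] [InnerProductSpace ℂ H]
    [CompleteSpace H] (π : A →⋆ₙₐ[ℂ] (H →L[ℂ] H)) (ξ : H) : Submodule ℂ H :=
  (Submodule.span ℂ {x : H | ∃ a : A, inducedForm g a a = 0 ∧ π a ξ = x}).topologicalClosure

instance (g : A →ₗ[ℂ] ℂ) {H : Type*} [NormedAddCommGroup H] [InnerProductSpace ℂ H]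
    [CompleteSpace H] (π : A →⋆ₙₐ[ℂ] (H →L[ℂ] H)) (ξ : H) :
    CompleteSpace (nullSpace g π ξ) :=
  (Submodule.isClosed_topologicalClosure _).completeSpace_coe

/-- The orthogonal projection of `H` onto `nullSpace g π ξ`. -/
noncomputable def nullProj (g : A →ₗ[ℂ] ℂ) {H : Type*} [NormedAddCommGroup H]
    [InnerProductSpace ℂ H] [CompleteSpace H] (π : A →⋆ₙₐ[ℂ] (H →L[ℂ] H)) (ξ : H) : H →L[ℂ] H :=
  (nullSpace g π ξ).starProjection

end Defs

end ShortDecomp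

namespace ShortDecomp

open ContinuousLinearMap

/-! ### *-representations, vector functionals, invariant subspaces -/

section Representation

variable {A : Type u} [NonUnitalRing A] [StarRing A] [Module ℂ A]
  {H : Type*} [NormedAddCommGroup H] [InnerProductSpace ℂ H] [CompleteSpace H]

/-! The `g`-null elements are the kernel of `a ↦ ρ a η` for a GNS triple of `g`, hence a left ideal
`N`. So the closure of `π(N)ξ` is invariant, its projection `P` commutes with `π`, and `f` splits
along `P` without cross terms.

The form of the first part is `‖π a ξ - P π a ξ‖²`, the infimum of `f ((a - b)* (a - b))` over `b ∈
N`. A representable `h ≪ g` is unchanged when `a` is replaced by `a - b`, so `h ≤ f` puts `h` below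
this infimum: that is maximality (`functionalLE_acPart`). The same shift makes the second part
singular (`singular_singPart`). A greatest element is unique because the quadratic form determines a
representable functional (`eq_of_inducedForm_self`); hence the formulas hold in every GNS triple. -/

lemma inner_map_star_left (π : A →⋆ₙₐ[ℂ] (H →L[ℂ] H)) (a : A) (x y : H) :
    ⟪π (star a) x, y⟫_ℂ = ⟪x, π a y⟫_ℂ := by
  rw [map_star, star_eq_adjoint, adjoint_inner_left]

lemma inner_map_star_right (π : A →⋆ₙₐ[ℂ] (H →L[ℂ] H)) (a : A) (x y : H) :
    ⟪x, π (star a) y⟫_ℂ = ⟪π a x, y⟫_ℂ := by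
  rw [map_star, star_eq_adjoint, adjoint_inner_right]

/-- The orbit map `a ↦ π a ζ`. -/
noncomputable def orbitMap (π : A →⋆ₙₐ[ℂ] (H →L[ℂ] H)) (ζ : H) : A →ₗ[ℂ] H where
  toFun a := π a ζ
  map_add' a b := by simp
  map_smul' c a := by simp

@[simp]
lemma orbitMap_apply (π : A →⋆ₙₐ[ℂ] (H →L[ℂ] H)) (ζ : H) (a : A) : orbitMap π ζ a = π a ζ := rfl

/-- The vector functional `a ↦ (π a ζ | ζ)`. -/
noncomputable def vectorFunctional (π : A →⋆ₙₐ[ℂ] (H →L[ℂ] H)) (ζ : H) : A →ₗ[ℂ] ℂ :=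
  (innerSL ℂ ζ).toLinearMap ∘ₗ orbitMap π ζ

@[simp]
lemma vectorFunctional_apply (π : A →⋆ₙₐ[ℂ] (H →L[ℂ] H)) (ζ : H) (a : A) :
    vectorFunctional π ζ a = ⟪ζ, π a ζ⟫_ℂ := rfl

lemma inducedForm_vectorFunctional (π : A →⋆ₙₐ[ℂ] (H →L[ℂ] H)) (ζ : H) (a : A) :
    inducedForm (vectorFunctional π ζ) a a = ((‖π a ζ‖ ^ 2 : ℝ) : ℂ) := by
  rw [inducedForm, vectorFunctional_apply, map_mul, mul_apply_eq_comp,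
    inner_map_star_right, inner_self_eq_norm_sq_to_K]
  push_cast
  rfl

lemma isPositive_vectorFunctional (π : A →⋆ₙₐ[ℂ] (H →L[ℂ] H)) (ζ : H) :
    IsPositive (vectorFunctional π ζ) := fun a => by
  rw [inducedForm_vectorFunctional]
  exact Complex.zero_le_real.2 (sq_nonneg _)

lemma starProjection_map_comm (π : A →⋆ₙₐ[ℂ] (H →L[ℂ] H)) (K : Submodule ℂ H) [CompleteSpace K]
    (hK : ∀ a, ∀ x ∈ K, π a x ∈ K) (a : A) (x : H) :
    K.starProjection (π a x) = π a (K.starProjection x) := by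
  refine Submodule.eq_starProjection_of_mem_of_inner_eq_zero
    (hK a _ (K.starProjection_apply_mem x)) fun w hw => ?_
  rw [← map_sub, ← star_star a, inner_map_star_left]
  exact Submodule.starProjection_inner_eq_zero x _ (hK _ _ hw)

/-- The restriction of a representation to a closed invariant subspace. -/
noncomputable def restrict (π : A →⋆ₙₐ[ℂ] (H →L[ℂ] H)) (K : Submodule ℂ H) [CompleteSpace K]
    (hK : ∀ a, ∀ x ∈ K, π a x ∈ K) : A →⋆ₙₐ[ℂ] (K →L[ℂ] K) where
  toFun a := ((π a).comp K.subtypeL).codRestrict K fun x => hK a x x.2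
  map_smul' c a := by ext x; simp; rfl
  map_zero' := by ext x; simp
  map_add' a b := by ext x; simp; rfl
  map_mul' a b := by ext x; simp; rfl
  map_star' a := by
    rw [star_eq_adjoint, eq_adjoint_iff]
    exact fun x y => inner_map_star_left π a x y

@[simp]
lemma coe_restrict_apply (π : A →⋆ₙₐ[ℂ] (H →L[ℂ] H)) (K : Submodule ℂ H) [CompleteSpace K]
    (hK : ∀ a, ∀ x ∈ K, π a x ∈ K) (a : A) (x : K) : (restrict π K hK a x : H) = π a x := rfl

lemma map_mem_topologicalClosure (π : A →⋆ₙₐ[ℂ] (H →L[ℂ] H)) (K : Submodule ℂ H)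
    (hK : ∀ a, ∀ x ∈ K, π a x ∈ K) (a : A) (x : H) (hx : x ∈ K.topologicalClosure) :
    π a x ∈ K.topologicalClosure :=
  map_mem_closure (π a).continuous hx fun y hy => hK a y hy

end Representation

/-! ### GNS triples, the null subspace and the two parts -/

section GNS

variable {A : Type u} [NonUnitalRing A] [StarRing A] [Module ℂ A]
  {H : Type*} [NormedAddCommGroup H] [InnerProductSpace ℂ H] [CompleteSpace H]
  {K : Type*} [NormedAddCommGroup K] [InnerProductSpace ℂ K] [CompleteSpace K]
  {f g h : A →ₗ[ℂ] ℂ} {π : A →⋆ₙₐ[ℂ] (H →L[ℂ] H)} {ξ : H} {ρ : A →⋆ₙₐ[ℂ] (K →L[ℂ] K)} {η : K}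

lemma IsGNSTriple.eq_vectorFunctional (hf : IsGNSTriple f π ξ) : f = vectorFunctional π ξ :=
  LinearMap.ext hf.apply_eq

lemma IsGNSTriple.inducedForm_self (hf : IsGNSTriple f π ξ) (a : A) :
    inducedForm f a a = ((‖π a ξ‖ ^ 2 : ℝ) : ℂ) := by
  rw [hf.eq_vectorFunctional, inducedForm_vectorFunctional]

lemma IsGNSTriple.inducedForm_self_eq_zero (hf : IsGNSTriple f π ξ) {a : A} :
    inducedForm f a a = 0 ↔ π a ξ = 0 := by
  rw [hf.inducedForm_self]
  simp

/-- Every vector functional is representable, even if the vector is not cyclic: project the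
vector onto the closure of its orbit. -/
theorem isRepresentable_vectorFunctional {H : Type u} [NormedAddCommGroup H]
    [InnerProductSpace ℂ H] [CompleteSpace H] (π : A →⋆ₙₐ[ℂ] (H →L[ℂ] H)) (ζ : H) :
    IsRepresentable (vectorFunctional π ζ) := by
  refine ⟨isPositive_vectorFunctional π ζ, ?_⟩
  set K : Submodule ℂ H := (LinearMap.range (orbitMap π ζ)).topologicalClosure with hKdef
  have hmem (a : A) : π a ζ ∈ K := Submodule.le_topologicalClosure _ ⟨a, rfl⟩
  have hK : ∀ a, ∀ x ∈ K, π a x ∈ K := by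
    refine map_mem_topologicalClosure π _ ?_
    rintro a _ ⟨b, rfl⟩
    exact ⟨a * b, by simp⟩
  have : CompleteSpace K := (Submodule.isClosed_topologicalClosure _).completeSpace_coe
  have hproj (a : A) : π a (K.starProjection ζ) = π a ζ := by
    rw [← starProjection_map_comm π K hK, Submodule.starProjection_eq_self_iff.mpr (hmem a)]
  refine ⟨K, inferInstance, inferInstance, inferInstance, restrict π K hK,
    ⟨K.starProjection ζ, K.starProjection_apply_mem ζ⟩, ?_, fun a => ?_⟩
  · intro x
    rw [closure_subtype, ← Set.range_comp]
    have : (Subtype.val ∘ fun a => restrict π K hK a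
        ⟨K.starProjection ζ, K.starProjection_apply_mem ζ⟩) = orbitMap π ζ :=
      funext fun a => hproj a
    rw [this]
    exact x.2
  · rw [vectorFunctional_apply, Submodule.coe_inner, coe_restrict_apply, hproj,
      Submodule.inner_starProjection_left_eq_right,
      Submodule.starProjection_eq_self_iff.mpr (hmem a)]

/-- Vector functionals of cyclic vectors are determined by their values `f (a* a)`. -/
theorem IsGNSTriple.eq_of_inducedForm_self (hf : IsGNSTriple f π ξ) (hg : IsGNSTriple g ρ η)
    (hfg : ∀ a, inducedForm f a a = inducedForm g a a) : f = g := by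
  have hnorm (a : A) : ‖orbitMap ρ η a‖ = ‖orbitMap π ξ a‖ := by
    have := hfg a
    rw [hf.inducedForm_self, hg.inducedForm_self] at this
    exact ((sq_eq_sq₀ (norm_nonneg _) (norm_nonneg _)).1 (by exact_mod_cast this)).symm
  have hd : DenseRange (orbitMap π ξ) := hf.cyclic
  -- Polarization would only give equality on products `b* a`, which need not exhaust a non-unital
  -- `A`. The isometric intertwiner `π a ξ ↦ ρ a η` is used instead.
  set T : H →L[ℂ] K := (orbitMap ρ η).extendOfNorm (orbitMap π ξ)
  have hT (a : A) : T (π a ξ) = ρ a η :=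
    LinearMap.extendOfNorm_eq hd ⟨1, fun a => by rw [hnorm, one_mul]⟩ a
  have hTnorm (x : H) : ‖T x‖ = ‖x‖ := by
    refine hd.induction_on x (isClosed_eq (by fun_prop) (by fun_prop)) fun a => ?_
    exact (congrArg norm (hT a)).trans (hnorm a)
  have hcomm (a : A) (x : H) : T (π a x) = ρ a (T x) := by
    refine hd.induction_on x (isClosed_eq (by fun_prop) (by fun_prop)) fun b => ?_
    have := hT (a * b)
    simpa [hT] using this
  -- `ξ` need not be of the form `π a ξ`; instead `ρ (a*)` kills `T ξ - η` for every `a`, so this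
  -- vector is orthogonal to the dense orbit of `η`.
  have hTξ : T ξ = η := by
    rw [← sub_eq_zero]
    refine hg.cyclic.eq_zero_of_inner_left (𝕜 := ℂ) ?_
    rintro _ ⟨a, rfl⟩
    change ⟪T ξ - η, ρ a η⟫_ℂ = 0
    rw [← inner_map_star_left, map_sub, ← hcomm, hT, sub_self, inner_zero_left]
  ext a
  rw [hf.apply_eq, hg.apply_eq, ← hT a, ← hTξ]
  exact ((LinearIsometry.mk T.toLinearMap hTnorm).inner_map_map ξ (π a ξ)).symm

theorem IsRepresentable.eq_of_functionalLE (hf : IsRepresentable f) (hg : IsRepresentable g)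
    (h₁ : FunctionalLE f g) (h₂ : FunctionalLE g f) : f = g := by
  obtain ⟨-, _, _, _, _, _, _, hf⟩ := hf
  obtain ⟨-, _, _, _, _, _, _, hg⟩ := hg
  exact hf.eq_of_inducedForm_self hg fun a => le_antisymm (h₁ a) (h₂ a)

theorem IsGNSTriple.eq_zero_of_inducedForm_self (hf : IsGNSTriple f π ξ)
    (h0 : ∀ a, inducedForm f a a = 0) : f = 0 := by
  ext a
  rw [hf.apply_eq, hf.inducedForm_self_eq_zero.1 (h0 a), inner_zero_right, LinearMap.zero_apply]

lemma IsGNSTriple.nullSpace_eq (hg : IsGNSTriple g ρ η) (π : A →⋆ₙₐ[ℂ] (H →L[ℂ] H)) (ξ : H) :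
    nullSpace g π ξ =
      ((LinearMap.ker (orbitMap ρ η)).map (orbitMap π ξ)).topologicalClosure := by
  rw [nullSpace]
  congr 1
  rw [← Submodule.span_eq ((LinearMap.ker (orbitMap ρ η)).map (orbitMap π ξ))]
  congr 1
  ext x
  simp [hg.inducedForm_self_eq_zero]

lemma IsGNSTriple.map_mem_nullSpace (hg : IsGNSTriple g ρ η) (π : A →⋆ₙₐ[ℂ] (H →L[ℂ] H)) (ξ : H) :
    ∀ a, ∀ x ∈ nullSpace g π ξ, π a x ∈ nullSpace g π ξ := by
  rw [hg.nullSpace_eq]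
  refine map_mem_topologicalClosure π _ ?_
  rintro a _ ⟨b, hb, rfl⟩
  refine ⟨a * b, ?_, by simp⟩
  have hb : ρ b η = 0 := hb
  simp [hb]

/-- The vectors `π b ξ` with `b` null already form a subspace, so no linear combinations have to be
checked. -/
lemma IsGNSTriple.nullSpace_induction (hg : IsGNSTriple g ρ η) {p : H → Prop}
    (hp : IsClosed {x | p x}) (hb : ∀ b, inducedForm g b b = 0 → p (π b ξ)) {x : H}
    (hx : x ∈ nullSpace g π ξ) : p x := by
  rw [hg.nullSpace_eq] at hx
  refine closure_minimal (t := {x | p x}) ?_ hp hx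
  rintro _ ⟨b, hb', rfl⟩
  exact hb b (hg.inducedForm_self_eq_zero.2 hb')

lemma map_mem_nullSpace_of_inducedForm_eq_zero {a : A} (ha : inducedForm g a a = 0) :
    π a ξ ∈ nullSpace g π ξ :=
  Submodule.le_topologicalClosure _ (Submodule.subset_span ⟨a, ha, rfl⟩)

lemma IsGNSTriple.nullProj_map (hg : IsGNSTriple g ρ η) (π : A →⋆ₙₐ[ℂ] (H →L[ℂ] H)) (ξ : H)
    (a : A) (x : H) : nullProj g π ξ (π a x) = π a (nullProj g π ξ x) :=
  starProjection_map_comm π _ (hg.map_mem_nullSpace π ξ) a x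

lemma nullProj_eq_self {x : H} (hx : x ∈ nullSpace g π ξ) : nullProj g π ξ x = x :=
  Submodule.starProjection_eq_self_iff.mpr hx

lemma nullProj_mem (x : H) : nullProj g π ξ x ∈ nullSpace g π ξ :=
  Submodule.starProjection_apply_mem _ x

/-- A representable `g`-absolutely continuous functional does not see `g`-null elements. -/
lemma IsRepresentable.inducedForm_sub_self (hh : IsRepresentable h) (hac : AbsCont h g)
    (a b : A) (hb : inducedForm g b b = 0) :
    inducedForm h (a - b) (a - b) = inducedForm h a a := by
  obtain ⟨-, _, _, _, _, _, _, hh⟩ := hh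
  rw [hh.inducedForm_self, hh.inducedForm_self, map_sub, sub_apply,
    hh.inducedForm_self_eq_zero.1 (hac b hb), sub_zero]

/-- The absolutely continuous part of the vector functional of `ξ`. -/
noncomputable def acPart (g : A →ₗ[ℂ] ℂ) (π : A →⋆ₙₐ[ℂ] (H →L[ℂ] H)) (ξ : H) : A →ₗ[ℂ] ℂ :=
  vectorFunctional π (ξ - nullProj g π ξ ξ)

/-- The singular part of the vector functional of `ξ`. -/
noncomputable def singPart (g : A →ₗ[ℂ] ℂ) (π : A →⋆ₙₐ[ℂ] (H →L[ℂ] H)) (ξ : H) : A →ₗ[ℂ] ℂ :=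
  vectorFunctional π (nullProj g π ξ ξ)

lemma IsGNSTriple.inducedForm_acPart (hg : IsGNSTriple g ρ η) (a : A) :
    inducedForm (acPart g π ξ) a a = ((‖π a ξ - nullProj g π ξ (π a ξ)‖ ^ 2 : ℝ) : ℂ) := by
  rw [acPart, inducedForm_vectorFunctional, map_sub, hg.nullProj_map]

lemma IsGNSTriple.inducedForm_singPart (hg : IsGNSTriple g ρ η) (a : A) :
    inducedForm (singPart g π ξ) a a = ((‖nullProj g π ξ (π a ξ)‖ ^ 2 : ℝ) : ℂ) := by
  rw [singPart, inducedForm_vectorFunctional, hg.nullProj_map]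

lemma IsGNSTriple.acPart_add_singPart (hf : IsGNSTriple f π ξ) (hg : IsGNSTriple g ρ η) :
    f = acPart g π ξ + singPart g π ξ := by
  ext a
  have h₁ : ⟪ξ - nullProj g π ξ ξ, π a (nullProj g π ξ ξ)⟫_ℂ = 0 :=
    Submodule.starProjection_inner_eq_zero ξ _ (hg.map_mem_nullSpace π ξ a _ (nullProj_mem ξ))
  have h₂ : ⟪nullProj g π ξ ξ, π a (ξ - nullProj g π ξ ξ)⟫_ℂ = 0 := by
    rw [← inner_map_star_left]
    exact Submodule.sub_starProjection_mem_orthogonal ξ _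
      (hg.map_mem_nullSpace π ξ _ _ (nullProj_mem ξ))
  rw [LinearMap.add_apply, acPart, singPart, vectorFunctional_apply, vectorFunctional_apply,
    hf.apply_eq]
  have h₃ : ξ = (ξ - nullProj g π ξ ξ) + nullProj g π ξ ξ := by abel
  conv_lhs => rw [h₃]
  rw [map_add, inner_add_left, inner_add_right, inner_add_right, h₁, h₂]
  ring

lemma IsGNSTriple.absCont_acPart (hg : IsGNSTriple g ρ η) : AbsCont (acPart g π ξ) g := by
  intro a ha
  rw [hg.inducedForm_acPart, nullProj_eq_self (map_mem_nullSpace_of_inducedForm_eq_zero ha)]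
  simp

lemma IsGNSTriple.acPart_functionalLE (hf : IsGNSTriple f π ξ) (hg : IsGNSTriple g ρ η) :
    FunctionalLE (acPart g π ξ) f := by
  intro a
  rw [hg.inducedForm_acPart, hf.inducedForm_self, Complex.real_le_real]
  gcongr
  simpa [nullProj, Submodule.starProjection_orthogonal_val] using
    (nullSpace g π ξ)ᗮ.norm_starProjection_apply_le (π a ξ)

theorem IsGNSTriple.functionalLE_acPart (hf : IsGNSTriple f π ξ) (hg : IsGNSTriple g ρ η)
    (hh : IsRepresentable h) (hhf : FunctionalLE h f) (hhg : AbsCont h g) :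
    FunctionalLE h (acPart g π ξ) := by
  intro a
  rw [hg.inducedForm_acPart]
  -- The bound is closed in `y` and holds at `y = π b ξ` with `b` null, so it passes to the nearest
  -- point `y = P π a ξ`.
  refine hg.nullSpace_induction (π := π) (ξ := ξ)
    (p := fun y => inducedForm h a a ≤ ((‖π a ξ - y‖ ^ 2 : ℝ) : ℂ))
    (isClosed_le (by fun_prop) (by fun_prop)) (fun b hb => ?_) (nullProj_mem (π a ξ))
  have := hhf (a - b)
  rwa [hf.inducedForm_self, hh.inducedForm_sub_self hhg a b hb, map_sub, sub_apply] at this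

theorem IsGNSTriple.singular_singPart (hg : IsGNSTriple g ρ η) : Singular (singPart g π ξ) g := by
  rintro h hh ⟨c, hc⟩ ⟨c', hc'⟩
  have hpos := hh.1
  have hac : AbsCont h g := fun a ha =>
    le_antisymm ((hc' a).trans_eq (by rw [ha, mul_zero])) (hpos a)
  have hzero (a : A) : inducedForm h a a = 0 := by
    refine le_antisymm ?_ (hpos a)
    -- Again `a` is shifted by null elements. At the limit `y = P π a ξ` the right side vanishes,
    -- whatever the sign of `c`.
    have key : inducedForm h a a ≤
        (c : ℂ) * ((‖nullProj g π ξ (π a ξ - nullProj g π ξ (π a ξ))‖ ^ 2 : ℝ) : ℂ) := by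
      refine hg.nullSpace_induction (π := π) (ξ := ξ)
        (p := fun y => inducedForm h a a ≤
          (c : ℂ) * ((‖nullProj g π ξ (π a ξ - y)‖ ^ 2 : ℝ) : ℂ))
        (isClosed_le (by fun_prop) (by fun_prop)) (fun b hb => ?_) (nullProj_mem (π a ξ))
      have := hc (a - b)
      rwa [hg.inducedForm_singPart, hh.inducedForm_sub_self hac a b hb, map_sub, sub_apply] at this
    rw [map_sub, nullProj_eq_self (nullProj_mem (π a ξ)), sub_self] at key
    simpa using key
  obtain ⟨-, _, _, _, _, _, _, ht⟩ := hh
  exact ht.eq_zero_of_inducedForm_self hzero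

end GNS

end ShortDecomp

theorem mainTheorem9 {A : Type u} [NonUnitalRing A] [StarRing A] [Module ℂ A]
    [IsScalarTower ℂ A A] [SMulCommClass ℂ A A] [StarModule ℂ A]
    (f g : A →ₗ[ℂ] ℂ) (hf : ShortDecomp.IsRepresentable f) (hg : ShortDecomp.IsRepresentable g) :
    ∃ fac fsing : A →ₗ[ℂ] ℂ,
      f = fac + fsing ∧
      ShortDecomp.IsRepresentable fac ∧ ShortDecomp.IsRepresentable fsing ∧
      ShortDecomp.AbsCont fac g ∧ ShortDecomp.Singular fsing g ∧
      -- `fac` is the greatest representable functional below `f` that is `g`-absolutely continuous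
      ShortDecomp.FunctionalLE fac f ∧
      (∀ h : A →ₗ[ℂ] ℂ, ShortDecomp.IsRepresentable h → ShortDecomp.FunctionalLE h f →
        ShortDecomp.AbsCont h g → ShortDecomp.FunctionalLE h fac) ∧
      -- the two parts are computed in any GNS triple of `f` by projecting the cyclic vector
      (∀ (H : Type u) [NormedAddCommGroup H] [InnerProductSpace ℂ H] [CompleteSpace H]
        (π : A →⋆ₙₐ[ℂ] (H →L[ℂ] H)) (ξ : H), ShortDecomp.IsGNSTriple f π ξ →
        ∀ a : A,
          fac a = ⟪ξ - ShortDecomp.nullProj g π ξ ξ, π a (ξ - ShortDecomp.nullProj g π ξ ξ)⟫_ℂ ∧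
          fsing a = ⟪ShortDecomp.nullProj g π ξ ξ, π a (ShortDecomp.nullProj g π ξ ξ)⟫_ℂ) := by
  have hg' := hg
  obtain ⟨-, K, _, _, _, ρ, η, hg⟩ := hg'
  obtain ⟨-, H, _, _, _, π, ξ, hf⟩ := hf
  have hrep := ShortDecomp.isRepresentable_vectorFunctional π (ξ - ShortDecomp.nullProj g π ξ ξ)
  have hsum := hf.acPart_add_singPart hg
  refine ⟨ShortDecomp.acPart g π ξ, ShortDecomp.singPart g π ξ, hsum, hrep,
    ShortDecomp.isRepresentable_vectorFunctional π _, hg.absCont_acPart, hg.singular_singPart,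
    hf.acPart_functionalLE hg, fun h hh hhf hhg => hf.functionalLE_acPart hg hh hhf hhg, ?_⟩
  intro H' _ _ _ π' ξ' hf' a
  have hrep' :=
    ShortDecomp.isRepresentable_vectorFunctional π' (ξ' - ShortDecomp.nullProj g π' ξ' ξ')
  -- Each is an admissible competitor for the maximality of the other.
  have hac : ShortDecomp.acPart g π ξ = ShortDecomp.acPart g π' ξ' :=
    hrep.eq_of_functionalLE hrep'
      (hf'.functionalLE_acPart hg hrep (hf.acPart_functionalLE hg) hg.absCont_acPart)
      (hf.functionalLE_acPart hg hrep' (hf'.acPart_functionalLE hg) hg.absCont_acPart)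
  have hsing : ShortDecomp.singPart g π ξ = ShortDecomp.singPart g π' ξ' :=
    add_left_cancel (hsum.symm.trans ((hf'.acPart_add_singPart hg).trans (by rw [hac])))
  exact ⟨LinearMap.congr_fun hac a, LinearMap.congr_fun hsing a⟩
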